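/- We consider first-order term rewriting with one sort, over a signature $\Sigma$ and an infinite set of variables. A \emph{rule} is a pair $\ell\to r$ of terms with $\ell$ not a variable; it is \emph{collapsing} if $r$ is a variable. A \emph{DP problem} is a triple $(\mathcal P,\mathcal R,f)$ of sets $\mathcal P,\mathcal R$ of rules over $\Sigma$ with $\mathrm{Var}(r)\subseteq\mathrm{Var}(\ell)$, and a flag $f\in\{\mathsf m,\mathsf a\}$. It is \emph{finite} if there is no infinite sequence $(\ell_i\to r_i,\gamma_i)_{i\in\mathbb N}$ of rules in $\mathcal P$ and substitutions with $r_i\gamma_i\to_{\mathcal R}^*\ell_{i+1}\gamma_{i+1}$ for all $i$ and, if $f=\mathsf m$, with all $r_i\gamma_i$ terminating with respect to $\to_{\mathcal R}$. A \emph{processor} maps DP problems to sets of DP problems; it is \emph{sound} if every DP problem $A$ is finite whenever all elements of its image are finite. A \emph{reduction pair} $(\succsim,\succ)$ consists of a monotonic quasi-ordering $\succsim$ and a well-founded ordering $\succ$ on terms, both closed under substitutions, with ${\succ}\cdot{\succsim}\subseteq{\succ}$. An \emph{argument filtering} $\pi$ maps each symbol $f$ of arity $n$ to a subset of $\{1,\dots,n\}$;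 $\overline\pi(t)$ replaces each subterm $f(s_1,\dots,s_n)$ of $t$ by $f_\pi(\overline\pi(s_{i_1}),\dots,\overline\pi(s_{i_k}))$, where $\pi(f)=\{i_1<\dots<i_k\}$. The trivial filtering $\pi_{\mathcal T}$ keeps all arguments. Let $\mathcal C_\epsilon=\{c(x,y)\to x,\ c(x,y)\to y\}$ for a fresh symbol $c$. For a set $R$ of rules, $\mathit{TCap}(f(s_1,\dots,s_n))=f(\mathit{TCap}(s_1),\dots,\mathit{TCap}(s_n))$ if this term does not unify with any left-hand side of $R$ (variables taken apart); in all other cases $\mathit{TCap}(s)$ is a fresh variable, a different one for every occurrence. \emph{Usable rules.} $\mathit{UR}_T(t,\mathcal R,\pi)$, for all terms $t$, are the least subsets of $\mathcal R$ such that: (i) if some term has infinitely many direct reducts for $\mathcal R$, then $\mathit{UR}_T(t,\mathcal R,\pi)=\mathcal R$; (ii) if $t=f(t_1,\dots,t_n)$, then $\mathit{UR}_T(t_i,\mathcal R,\pi)\subseteq\mathit{UR}_T(t,\mathcal R,\pi)$ for $i\in\pi(f)$, and each $\ell\to r\in\mathcal R$ such that $f(\mathit{TCap}(t_1),\dots,\mathit{TCap}(t_n))$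 unifies with $\ell$ is in $\mathit{UR}_T(t,\mathcal R,\pi)$; (iii) if $\ell\to r\in\mathit{UR}_T(t,\mathcal R,\pi)$, then $\mathit{UR}_T(r,\mathcal R,\pi)\subseteq\mathit{UR}_T(t,\mathcal R,\pi)$. Here $\mathit{TCap}$ is taken with respect to $\mathcal R$. Put $\mathit{UR}_T(\mathcal P,\mathcal R,\pi)=\bigcup_{s\to t\in\mathcal P}\mathit{UR}_T(t,\mathcal R,\pi)$. \emph{Combined rules.} For a set $U$ of rules let $X$ be the least set of rules containing $U$ such that for all $\ell\to r\in X$: if $r$ is a variable, $f(l_1,\dots,l_n)$ is a subterm of $\ell$ and $r$ is a subterm of $l_i$, then $f(x_1,\dots,x_n)\to x_i\in X$; and if $r=f(r_1,\dots,r_n)$ and $f(x_1,\dots,x_n)\to x_i\in X$, then $\ell\to r_i\in X$ (with $x_1,x_2,\dots$ fixed distinct variables). Then $A_U$ consists of the rules of the form $f(x_1,\dots,x_n)\to x_i$ in $X$ and of the non-collapsing rules in $X$. \emph{Split-formative rules.} For a set $A$ of rules, $\mathit{SR}_T(t,A,\pi)$, for all terms $t$, are the least subsets of $A$ such that: (i)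 if $t$ is not linear, then $\mathit{SR}_T(t,A,\pi)=A$; (ii) all collapsing rules of $A$ are in $\mathit{SR}_T(t,A,\pi)$; (iii) if $t=f(t_1,\dots,t_n)$, then $\mathit{SR}_T(t_i,A,\pi)\subseteq\mathit{SR}_T(t,A,\pi)$ for $i\in\pi(f)$, and each rule $\ell\to f(r_1,\dots,r_n)\in A$ such that $f(\mathit{TCap}(r_1),\dots,\mathit{TCap}(r_n))$ unifies with $t$ is in $\mathit{SR}_T(t,A,\pi)$; (iv) if $\ell\to r\in\mathit{SR}_T(t,A,\pi)$ and $r$ is not a variable, then $\mathit{SR}_T(\ell,A,\pi)\subseteq\mathit{SR}_T(t,A,\pi)$. Here $\mathit{TCap}$ is taken with respect to $A$. Put $\mathit{SR}_T(\mathcal P,A,\pi)=\bigcup_{s\to t\in\mathcal P}\mathit{SR}_T(s,A,\pi)$. \textbf{Theorem.} Let $\pi$ be an argument filtering on $\Sigma\cup\{c\}$ and $(\succsim,\succ)$ a reduction pair on the terms over the filtered symbols $f_\pi$, $f\in\Sigma\cup\{c\}$. Let a set $\mathcal P^\succ$ of rules be chosen for every DP problem $(\mathcal P,\mathcal R,f)$.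 Then the processor which maps a DP problem $(\mathcal P,\mathcal R,f)$ to the following result is sound: \begin{itemize} \item $\{(\mathcal P\setminus\mathcal P^\succ,\mathcal R,f)\}$ if $\mathcal P^\succ\subseteq\mathcal P$ and \begin{itemize} \item $\overline\pi(\ell)\succ\overline\pi(r)$ for all $\ell\to r\in\mathcal P^\succ$ and $\overline\pi(\ell)\succsim\overline\pi(r)$ for all $\ell\to r\in\mathcal P\setminus\mathcal P^\succ$, and \item $\overline\pi(\ell)\succsim\overline\pi(r)$ for all $\ell\to r\in\mathit{SR}_T(\mathcal P,A_U,\pi)$, where $U=\mathcal R$ if $f=\mathsf a$ and $U=\mathit{UR}_T(\mathcal P,\mathcal R,\pi_{\mathcal T})\cup\mathcal C_\epsilon$ if $f=\mathsf m$; \end{itemize} \item $\{(\mathcal P,\mathcal R,f)\}$ otherwise. \end{itemize} -/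

import Mathlib

universe u v w w'

namespace TRS

open FirstOrder.Language

/-! First-order (one-sorted) term rewriting. A signature is the functional part of a
`FirstOrder.Language`; terms over `L` with variables in `V` are `L.Term V`; substitutions are maps
`V → L.Term V`, applied by `Term.subst`. -/

variable {L : FirstOrder.Language.{u, v}} {V : Type w} {W : Type w'}

/-- `Subterm s t` is `s ⊵ t`. -/
inductive Subterm : L.Term V → L.Term V → Prop
  | refl (s : L.Term V) : Subterm s s
  | arg {n : ℕ} (f : L.Functions n) (ts : Fin n → L.Term V) (i : Fin n) (t : L.Term V) :
      Subterm (ts i) t → Subterm (Term.func f ts) t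

/-- The set of variables of a term. -/
def vars (t : L.Term V) : Set V := {x | Subterm t (Term.var x)}

/-- The term is a variable. -/
def IsVar (t : L.Term V) : Prop := ∃ x : V, t = Term.var x

open Classical in
/-- The number of occurrences of the variable `x` in a term. -/
noncomputable def occ (x : V) : L.Term V → ℕ
  | Term.var y => if y = x then 1 else 0
  | Term.func _ ts => ∑ i, occ x (ts i)

/-- A term is linear if no variable occurs more than once in it. -/
def Linear (t : L.Term V) : Prop := ∀ x : V, occ x t ≤ 1

/-- A pair of terms `lhs → rhs`. -/
@[ext]
structure Rule (L : FirstOrder.Language.{u, v}) (V : Type w) where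
  lhs : L.Term V
  rhs : L.Term V

/-- One rewrite step with the rules of `R`. -/
inductive Step (R : Set (Rule L V)) : L.Term V → L.Term V → Prop
  | root (ρ : Rule L V) (γ : V → L.Term V) : ρ ∈ R → Step R (ρ.lhs.subst γ) (ρ.rhs.subst γ)
  | arg {n : ℕ} (f : L.Functions n) (ts : Fin n → L.Term V) (i : Fin n) (t : L.Term V) :
      Step R (ts i) t →
        Step R (Term.func f ts) (Term.func f (Function.update ts i t))

/-- Zero or more rewrite steps. -/
def Steps (R : Set (Rule L V)) : L.Term V → L.Term V → Prop := Relation.ReflTransGen (Step R)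

/-- There is no infinite reduction from `s`. -/
def Terminating (R : Set (Rule L V)) (s : L.Term V) : Prop :=
  ¬ ∃ u : ℕ → L.Term V, u 0 = s ∧ ∀ n, Step R (u n) (u (n + 1))

/-- Every term has only finitely many direct reducts. -/
def FinitelyBranching (R : Set (Rule L V)) : Prop := ∀ s : L.Term V, {t | Step R s t}.Finite

/-! ### Dependency pair problems -/

/-- `(ρ i, γ i)` is an infinite `(P, R)`-chain. -/
def IsChain (P R : Set (Rule L V)) (ρ : ℕ → Rule L V) (γ : ℕ → V → L.Term V) : Prop :=
  (∀ i, ρ i ∈ P) ∧ ∀ i, Steps R ((ρ i).rhs.subst (γ i)) ((ρ (i + 1)).lhs.subst (γ (i + 1)))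

/-- The minimality condition on chains. -/
def IsMinimalChain (R : Set (Rule L V)) (ρ : ℕ → Rule L V) (γ : ℕ → V → L.Term V) : Prop :=
  ∀ i, Terminating R ((ρ i).rhs.subst (γ i))

/-- The flag of a dependency pair problem. -/
inductive Flag
  | minimal
  | arbitrary

/-- A dependency pair problem `(P, R, f)`. Left-hand sides are not variables, and right-hand sides
contain no variables that are not in the left-hand side. -/
structure DPProblem (L : FirstOrder.Language.{u, v}) (V : Type w) where
  P : Set (Rule L V)
  R : Set (Rule L V)
  flag : Flag
  P_lhs : ∀ ρ ∈ P, ¬ IsVar ρ.lhs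
  P_vars : ∀ ρ ∈ P, vars ρ.rhs ⊆ vars ρ.lhs
  R_lhs : ∀ ρ ∈ R, ¬ IsVar ρ.lhs
  R_vars : ∀ ρ ∈ R, vars ρ.rhs ⊆ vars ρ.lhs

/-- There is no infinite `(P, R)`-chain (no minimal one, if the flag is `minimal`). -/
def DPProblem.IsFinite (A : DPProblem L V) : Prop :=
  ¬ ∃ (ρ : ℕ → Rule L V) (γ : ℕ → V → L.Term V),
    IsChain A.P A.R ρ γ ∧ (A.flag = Flag.minimal → IsMinimalChain A.R ρ γ)

/-- The problem `(P \ Q, R, f)`. -/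
def DPProblem.remove (A : DPProblem L V) (Q : Set (Rule L V)) : DPProblem L V where
  P := A.P \ Q
  R := A.R
  flag := A.flag
  P_lhs ρ h := A.P_lhs ρ h.1
  P_vars ρ h := A.P_vars ρ h.1
  R_lhs := A.R_lhs
  R_vars := A.R_vars

/-- A processor is sound if a problem is finite whenever all problems it is mapped to are. -/
def Sound (proc : DPProblem L V → Set (DPProblem L V)) : Prop :=
  ∀ A, (∀ B ∈ proc A, B.IsFinite) → A.IsFinite

/-- A reduction pair on the terms over `L`: `ge` is a monotonic stable quasi-ordering, `gt` a
well-founded stable ordering, and `gt · ge ⊆ gt`. -/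
structure ReductionPair (L : FirstOrder.Language.{u, v}) (V : Type w) where
  ge : L.Term V → L.Term V → Prop
  gt : L.Term V → L.Term V → Prop
  ge_refl : ∀ s, ge s s
  ge_trans : ∀ s t q, ge s t → ge t q → ge s q
  ge_mono : ∀ {n : ℕ} (f : L.Functions n) (ts : Fin n → L.Term V) (i : Fin n) (t : L.Term V),
    ge (ts i) t → ge (Term.func f ts) (Term.func f (Function.update ts i t))
  ge_stable : ∀ s t (γ : V → L.Term V), ge s t → ge (s.subst γ) (t.subst γ)
  gt_trans : ∀ s t q, gt s t → gt t q → gt s q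
  gt_wf : WellFounded fun s t => gt t s
  gt_stable : ∀ s t (γ : V → L.Term V), gt s t → gt (s.subst γ) (t.subst γ)
  gt_ge : ∀ s t q, gt s t → ge t q → gt s q

/-! ### Argument filterings -/

/-- An argument filtering maps each symbol to a set of its argument places. -/
def ArgFiltering (L : FirstOrder.Language.{u, v}) : Type u := ∀ n : ℕ, L.Functions n → Finset (Fin n)

/-- The trivial filtering, which keeps all arguments. -/
def trivialFiltering (L : FirstOrder.Language.{u, v}) : ArgFiltering L := fun _ _ => Finset.univ

/-- The signature of the symbols `f_π`, with arity the number of elements of `π f`. -/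
def filteredLanguage (π : ArgFiltering L) : FirstOrder.Language.{u, 0} where
  Functions k := {f : Σ n, L.Functions n // (π f.1 f.2).card = k}
  Relations _ := Empty

/-- The filtered term: `f(s₁,…,sₙ)` becomes `f_π` applied to the filtered `sᵢ` with `i ∈ π f`, in
increasing order of `i`. -/
def filterTerm (π : ArgFiltering L) : L.Term V → (filteredLanguage π).Term V
  | Term.var x => Term.var x
  | @Term.func _ _ n f ts =>
      Term.func (L := filteredLanguage π) (l := (π n f).card) ⟨⟨n, f⟩, rfl⟩
        fun j => filterTerm π (ts ((π n f).orderEmbOfFin rfl j))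

/-! ### `TCap` -/

/-- Two terms whose variables are taken to be disjoint unify. -/
def Unifies (s : L.Term W) (t : L.Term V) : Prop :=
  ∃ (σ : W → L.Term V) (τ : V → L.Term V), s.subst σ = t.subst τ

/-- `f(u₁,…,uₙ)` where the variable of `uᵢ` at position `p` is renamed to the one for `i · p`. -/
def capApp {n : ℕ} (f : L.Functions n) (us : Fin n → L.Term (List ℕ)) : L.Term (List ℕ) :=
  Term.func f fun i => (us i).relabel fun p => i.val :: p

open Classical in
/-- `TCap(s, R)`. The fresh variable that replaces an occurrence of a subterm of `s` is named by the
position of that occurrence, so that different occurrences get different variables; these variables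
are of another type than those of the rules. -/
noncomputable def tcap (R : Set (Rule L V)) : L.Term V → L.Term (List ℕ)
  | Term.var _ => Term.var []
  | Term.func f ts =>
      if ∃ ρ ∈ R, Unifies (capApp f fun i => tcap R (ts i)) ρ.lhs then Term.var []
      else capApp f fun i => tcap R (ts i)

/-! ### Usable rules with `TCap` -/

/-- `UsableT R π t ρ` says that `ρ` is in the least set of usable rules of `t`. -/
inductive UsableT (R : Set (Rule L V)) (π : ArgFiltering L) : L.Term V → Rule L V → Prop
  | infinite (t : L.Term V) (ρ : Rule L V) : ¬ FinitelyBranching R → ρ ∈ R → UsableT R π t ρ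
  | arg {n : ℕ} (f : L.Functions n) (ts : Fin n → L.Term V) (i : Fin n) (ρ : Rule L V) :
      i ∈ π n f → UsableT R π (ts i) ρ → UsableT R π (Term.func f ts) ρ
  | cap {n : ℕ} (f : L.Functions n) (ts : Fin n → L.Term V) (ρ : Rule L V) :
      ρ ∈ R → Unifies (capApp f fun i => tcap R (ts i)) ρ.lhs →
        UsableT R π (Term.func f ts) ρ
  | rhs (t : L.Term V) (ρ ρ' : Rule L V) :
      UsableT R π t ρ → UsableT R π ρ.rhs ρ' → UsableT R π t ρ'

/-- `UR_T(P, R, π)`. -/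
def usableRulesT (P R : Set (Rule L V)) (π : ArgFiltering L) : Set (Rule L V) :=
  {ρ | ∃ p ∈ P, UsableT R π p.rhs ρ}

/-! ### Combining rules -/

/-- Pairwise different variables `x₀, x₁, …`. -/
noncomputable def stdVar (V : Type w) [Infinite V] : ℕ → V := Infinite.natEmbedding V

/-- The rule `f(x₁,…,xₙ) → xᵢ`. -/
noncomputable def projRule [Infinite V] {n : ℕ} (f : L.Functions n) (i : Fin n) : Rule L V where
  lhs := Term.func f fun j => Term.var (stdVar V j)
  rhs := Term.var (stdVar V i)

/-- The least set `X` that contains `R` and is closed under splitting and combining. -/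
inductive Combined [Infinite V] (R : Set (Rule L V)) : Rule L V → Prop
  | base (ρ : Rule L V) : ρ ∈ R → Combined R ρ
  | split (ρ : Rule L V) {n : ℕ} (f : L.Functions n) (ls : Fin n → L.Term V) (i : Fin n) :
      Combined R ρ → IsVar ρ.rhs → Subterm ρ.lhs (Term.func f ls) →
        Subterm (ls i) ρ.rhs → Combined R (projRule f i)
  | combine (l : L.Term V) {n : ℕ} (f : L.Functions n) (rs : Fin n → L.Term V) (i : Fin n) :
      Combined R ⟨l, Term.func f rs⟩ → Combined R (projRule f i) →
        Combined R ⟨l, rs i⟩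

/-- `A_R`: the rules `f(x₁,…,xₙ) → xᵢ` in `X` and the non-collapsing rules in `X`. -/
def combinedRules [Infinite V] (R : Set (Rule L V)) : Set (Rule L V) :=
  {ρ | Combined R ρ ∧
    ((∃ (n : ℕ) (f : L.Functions n) (i : Fin n), ρ = projRule f i) ∨ ¬ IsVar ρ.rhs)}

/-! ### Split-formative rules with `TCap` and an argument filtering -/

/-- `SplitFormativeT A π t ρ` says that `ρ` is in the least set of split-formative rules of `t`. -/
inductive SplitFormativeT (A : Set (Rule L V)) (π : ArgFiltering L) :
    L.Term V → Rule L V → Prop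
  | nonlinear (t : L.Term V) (ρ : Rule L V) : ¬ Linear t → ρ ∈ A → SplitFormativeT A π t ρ
  | collapsing (t : L.Term V) (ρ : Rule L V) : ρ ∈ A → IsVar ρ.rhs → SplitFormativeT A π t ρ
  | arg {n : ℕ} (f : L.Functions n) (ts : Fin n → L.Term V) (i : Fin n) (ρ : Rule L V) :
      i ∈ π n f → SplitFormativeT A π (ts i) ρ → SplitFormativeT A π (Term.func f ts) ρ
  | cap {n : ℕ} (f : L.Functions n) (ts rs : Fin n → L.Term V) (ρ : Rule L V) :
      ρ ∈ A → ρ.rhs = Term.func f rs →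
        Unifies (capApp f fun i => tcap A (rs i)) (Term.func f ts) →
          SplitFormativeT A π (Term.func f ts) ρ
  | lhs (t : L.Term V) (ρ ρ' : Rule L V) :
      SplitFormativeT A π t ρ → ¬ IsVar ρ.rhs → SplitFormativeT A π ρ.lhs ρ' →
        SplitFormativeT A π t ρ'

/-- `SR_T(P, A, π)`. -/
def splitFormativeRulesT (P A : Set (Rule L V)) (π : ArgFiltering L) : Set (Rule L V) :=
  {ρ | ∃ p ∈ P, SplitFormativeT A π p.lhs ρ}

/-! ### The extra symbol `c` -/

/-- The binary symbol `c`. -/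
inductive CSymbol : ℕ → Type
  | c : CSymbol 2

/-- The signature whose only symbol is `c`. -/
def cLanguage : FirstOrder.Language.{0, 0} where
  Functions := CSymbol
  Relations _ := Empty

/-- The signature `L` with a fresh binary symbol `c`. -/
abbrev withC (L : FirstOrder.Language.{u, v}) : FirstOrder.Language.{u, v} := L.sum cLanguage

/-- A rule over `L`, seen as a rule over the larger signature. -/
def Rule.toC (ρ : Rule L V) : Rule (withC L) V where
  lhs := LHom.sumInl.onTerm ρ.lhs
  rhs := LHom.sumInl.onTerm ρ.rhs

/-- `C_ε`, that is, the rules `c(x, y) → x` and `c(x, y) → y`. -/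
def cEpsilon (L : FirstOrder.Language.{u, v}) (V : Type w) [Infinite V] : Set (Rule (withC L) V) :=
  {ρ | ∃ i : Fin 2, ρ = projRule (L := withC L) (n := 2) (Sum.inr CSymbol.c) i}

/-! ### The processor -/

/-- `U`, which is `R` if the flag is `arbitrary`, and `UR_T(P, R, π_T) ∪ C_ε` if it is
`minimal`. -/
def relevantRules [Infinite V] (A : DPProblem L V) : Set (Rule (withC L) V) :=
  match A.flag with
  | Flag.arbitrary => Rule.toC '' A.R
  | Flag.minimal => Rule.toC '' usableRulesT A.P A.R (trivialFiltering L) ∪ cEpsilon L V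

/-- The condition under which the pairs `Q` (that is, `P^≻`) are removed from `A`. -/
def Orients [Infinite V] (π : ArgFiltering (withC L)) (rp : ReductionPair (filteredLanguage π) V)
    (A : DPProblem L V) (Q : Set (Rule L V)) : Prop :=
  Q ⊆ A.P ∧
  (∀ ρ ∈ Q, rp.gt (filterTerm π ρ.toC.lhs) (filterTerm π ρ.toC.rhs)) ∧
  (∀ ρ ∈ A.P \ Q, rp.ge (filterTerm π ρ.toC.lhs) (filterTerm π ρ.toC.rhs)) ∧
  ∀ ρ ∈ splitFormativeRulesT (Rule.toC '' A.P) (combinedRules (relevantRules A)) π,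
    rp.ge (filterTerm π ρ.lhs) (filterTerm π ρ.rhs)

open Classical in
/-- The reduction pair processor with split-formative rules; `S A` is the set `P^≻` for the
problem `A`. -/
noncomputable def splitFormativeProcessor [Infinite V] (π : ArgFiltering (withC L))
    (rp : ReductionPair (filteredLanguage π) V) (S : DPProblem L V → Set (Rule L V))
    (A : DPProblem L V) : Set (DPProblem L V) :=
  if Orients π rp A (S A) then {A.remove (S A)} else {A}

end TRS

/-! Let an infinite chain be given. Only finitely many of its pairs can be in the removed set, so a
tail of it is a chain of the smaller problem.

The chain is turned into one whose connecting reductions use only the rules of `U` over the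
signature with `c` (`exists_chain_relevantRules`). With the flag `minimal` this uses an
interpretation of terminating terms: a term that some rule outside `U` could reach at its root
becomes a `c`-list of its interpreted reducts, so that `C_ε` can pick the wanted reduct (`interp`,
`steps_interp`). All other terms keep their root symbol, and `TCap` guarantees this for right-hand
sides of pairs and of rules in `U`.

The reductions need not be weakly decreasing, since only the split-formative rules are oriented. But
a reduction from `s` to an instance `lγ` can be reorganised: only the steps that build the pattern
`l` are done, the others are postponed into the substitution. This gives `δ` with `s ≿ lδ` after
filtering, where `δ` reduces to `γ` (`exists_ge_filterTerm`). The induction is on the number of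
parallel steps with rules of the closure `X` of `U`. Collapsing steps are the obstacle; they are
split into projections `f(x₁,…,xₙ) → xᵢ` and moved to the front, and closure under combination makes
this possible without extra parallel steps (`exists_projs_parN`). Passing the postponed steps on
from pair to pair yields a decreasing sequence of filtered terms (`eventually_not_strict_of_chain`).
-/

namespace TRS

open FirstOrder.Language

/-! ### Substitutions, subterms, variables and linearity. -/

section Basic

variable {L : FirstOrder.Language.{u, v}} {V : Type w} {W : Type w'}

@[simp] theorem subst_var (x : V) (γ : V → L.Term W) : (Term.var x : L.Term V).subst γ = γ x := rfl

@[simp] theorem subst_func {n : ℕ} (f : L.Functions n) (ts : Fin n → L.Term V)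
    (γ : V → L.Term W) :
    (Term.func f ts).subst γ = Term.func f fun i => (ts i).subst γ := rfl

theorem subst_relabel {W' : Type*} (t : L.Term V) (g : V → W) (γ : W → L.Term W') :
    (t.relabel g).subst γ = t.subst (γ ∘ g) := by
  induction t with
  | var x => rfl
  | func f ts ih => simp [ih]

/-- A relation on results that is closed under changing one argument is closed under changing all
arguments. -/
theorem congr_of_update {α β : Type*} {n : ℕ} {q : α → α → Prop} {r : β → β → Prop}
    (hrefl : ∀ b, r b b) (htrans : ∀ a b c, r a b → r b c → r a c) (F : (Fin n → α) → β)
    (hF : ∀ ts i t, q (ts i) t → r (F ts) (F (Function.update ts i t)))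
    {ts us : Fin n → α} (h : ∀ i, q (ts i) (us i)) : r (F ts) (F us) := by
  have key : ∀ s : Finset (Fin n), r (F ts) (F fun i => if i ∈ s then us i else ts i) := by
    intro s
    induction s using Finset.induction_on with
    | empty => simpa using hrefl _
    | insert a s ha ih =>
      refine htrans _ _ _ ih ?_
      have := hF (fun i => if i ∈ s then us i else ts i) a (us a) (by simpa [ha] using h a)
      convert this using 2
      ext i
      by_cases hi : i = a
      · subst hi; simp
      · simp [hi]
  simpa using key Finset.univ

theorem mem_vars_var {x y : V} : x ∈ vars (Term.var y : L.Term V) ↔ x = y := by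
  constructor
  · intro h
    change Subterm _ _ at h
    generalize hs : (Term.var y : L.Term V) = s at h
    generalize ht : (Term.var x : L.Term V) = t at h
    cases h with
    | refl => rw [← hs] at ht; injection ht
    | arg => cases hs
  · rintro rfl
    exact Subterm.refl _

theorem subterm_func_inv {n : ℕ} {f : L.Functions n} {ts : Fin n → L.Term V} {t : L.Term V}
    (h : Subterm (Term.func f ts) t) : t = Term.func f ts ∨ ∃ i, Subterm (ts i) t := by
  generalize hs : Term.func f ts = s at h
  cases h with
  | refl => exact Or.inl rfl
  | arg g us i _ h' => cases hs; exact Or.inr ⟨i, h'⟩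

theorem mem_vars_func {x : V} {n : ℕ} {f : L.Functions n} {ts : Fin n → L.Term V} :
    x ∈ vars (Term.func f ts) ↔ ∃ i, x ∈ vars (ts i) := by
  constructor
  · intro h
    rcases subterm_func_inv h with h | h
    · cases h
    · exact h
  · rintro ⟨i, hi⟩
    exact Subterm.arg f ts i _ hi

theorem Subterm.trans {s t q : L.Term V} (h : Subterm s t) (h' : Subterm t q) : Subterm s q := by
  induction h with
  | refl => exact h'
  | arg f ts i _ _ ih => exact Subterm.arg f ts i _ (ih h')

theorem subst_congr {t : L.Term V} {γ δ : V → L.Term W} (h : ∀ x ∈ vars t, γ x = δ x) :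
    t.subst γ = t.subst δ := by
  induction t with
  | var x => exact h x (mem_vars_var.2 rfl)
  | func f ts ih =>
    simp only [subst_func]
    congr 1
    ext i
    exact ih i fun x hx => h x (mem_vars_func.2 ⟨i, hx⟩)

theorem one_le_occ {x : V} {t : L.Term V} (h : x ∈ vars t) : 1 ≤ occ x t := by
  induction t with
  | var y => rw [mem_vars_var] at h; simp [occ, h]
  | func f ts ih =>
    obtain ⟨i, hi⟩ := mem_vars_func.1 h
    simp only [occ]
    exact (ih i hi).trans
      (Finset.single_le_sum (f := fun i => occ x (ts i)) (fun _ _ => Nat.zero_le _)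
        (Finset.mem_univ i))

theorem Linear.disjoint {n : ℕ} {f : L.Functions n} {ts : Fin n → L.Term V}
    (h : Linear (Term.func f ts)) {x : V} {i j : Fin n} (hi : x ∈ vars (ts i))
    (hj : x ∈ vars (ts j)) : i = j := by
  by_contra hij
  have h1 := h x
  simp only [occ] at h1
  have h2 : ∑ k ∈ ({i, j} : Finset (Fin n)), occ x (ts k) ≤ ∑ k, occ x (ts k) :=
    Finset.sum_le_sum_of_subset (Finset.subset_univ _)
  rw [Finset.sum_pair hij] at h2
  have := one_le_occ hi
  have := one_le_occ hj
  omega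

/-! ### Rewriting -/

theorem step_func_inv {R : Set (Rule L V)} {n : ℕ} {f : L.Functions n} {ts : Fin n → L.Term V}
    {t : L.Term V} (h : Step R (Term.func f ts) t) :
    (∃ ρ ∈ R, ∃ γ : V → L.Term V, Term.func f ts = ρ.lhs.subst γ ∧ t = ρ.rhs.subst γ) ∨
      ∃ i u, Step R (ts i) u ∧ t = Term.func f (Function.update ts i u) := by
  generalize hs : Term.func f ts = s at h
  cases h with
  | root ρ γ hρ => exact Or.inl ⟨ρ, hρ, γ, rfl, rfl⟩
  | arg g us i u hu => cases hs; exact Or.inr ⟨i, u, hu, rfl⟩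

theorem Step.mono {R R' : Set (Rule L V)} (h : R ⊆ R') {s t : L.Term V} (hs : Step R s t) :
    Step R' s t := by
  induction hs with
  | root ρ γ hρ => exact Step.root ρ γ (h hρ)
  | arg f ts i t _ ih => exact Step.arg f ts i t ih

theorem Steps.mono {R R' : Set (Rule L V)} (h : R ⊆ R') {s t : L.Term V} (hs : Steps R s t) :
    Steps R' s t :=
  Relation.ReflTransGen.mono (fun _ _ => Step.mono h) _ _ hs

theorem Steps.update {R : Set (Rule L V)} {n : ℕ} (f : L.Functions n) (ts : Fin n → L.Term V)
    (i : Fin n) {t : L.Term V} (h : Steps R (ts i) t) :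
    Steps R (Term.func f ts) (Term.func f (Function.update ts i t)) := by
  induction h with
  | refl => rw [Function.update_eq_self]; exact Relation.ReflTransGen.refl
  | @tail b c _ hbc ih =>
    refine ih.tail ?_
    have := Step.arg (R := R) f (Function.update ts i b) i c (by simpa using hbc)
    simpa using this

theorem Steps.func {R : Set (Rule L V)} {n : ℕ} (f : L.Functions n) {ts us : Fin n → L.Term V}
    (h : ∀ i, Steps R (ts i) (us i)) : Steps R (Term.func f ts) (Term.func f us) :=
  congr_of_update (q := Steps R) (r := Steps R) (fun _ => Relation.ReflTransGen.refl)
    (fun _ _ _ => Relation.ReflTransGen.trans) (Term.func f) (fun ts i _ => Steps.update f ts i) h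

/-! ### `TCap` -/

/-- The term is an instance of `u`. -/
def Inst (u : L.Term W) (t : L.Term V) : Prop := ∃ σ : W → L.Term V, t = u.subst σ

theorem inst_var (x : W) (t : L.Term V) : Inst (Term.var x : L.Term W) t := ⟨fun _ => t, rfl⟩

theorem inst_capApp {n : ℕ} {f : L.Functions n} {us : Fin n → L.Term (List ℕ)}
    {ts : Fin n → L.Term V} :
    Inst (capApp f us) (Term.func f ts) ↔ ∀ i, Inst (us i) (ts i) := by
  constructor
  · rintro ⟨σ, hσ⟩ i
    simp only [capApp, subst_func, subst_relabel] at hσ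
    injection hσ with _ _ h
    exact ⟨_, congrFun h i⟩
  · intro h
    choose σ hσ using h
    -- The head of a position tells which argument it belongs to, so the substitutions for the
    -- arguments do not clash. The defaults concern positions that do not occur in `capApp f us`.
    refine ⟨fun p => match p with
      | [] => Term.func f ts
      | k :: p => if hk : k < n then σ ⟨k, hk⟩ p else Term.func f ts, ?_⟩
    simp only [capApp, subst_func, subst_relabel]
    congr 1
    ext i
    rw [hσ i]
    congr 1
    ext p
    simp

theorem Inst.exists_func {n : ℕ} {f : L.Functions n} {us : Fin n → L.Term (List ℕ)}
    {t : L.Term V} (h : Inst (capApp f us) t) : ∃ ts, t = Term.func f ts := by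
  obtain ⟨σ, rfl⟩ := h
  exact ⟨_, rfl⟩

theorem inst_tcap_subst (R : Set (Rule L V)) (t : L.Term V) (γ : V → L.Term V) :
    Inst (tcap R t) (t.subst γ) := by
  induction t with
  | var x => simp only [tcap]; exact inst_var _ _
  | func f ts ih =>
    simp only [tcap]
    split_ifs
    · exact inst_var _ _
    · exact inst_capApp.2 ih

/-- Where `tcap R s` has a function symbol, the capped term there unifies with no left-hand side, so
no step happens at that position. A step below a variable of the cap only changes the value of that
variable, because the variables are pairwise distinct. -/
theorem Inst.tcap_step {R : Set (Rule L V)} {s t t' : L.Term V} (h : Inst (tcap R s) t)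
    (ht : Step R t t') : Inst (tcap R s) t' := by
  induction s generalizing t t' with
  | var x => simp only [tcap]; exact inst_var _ _
  | func f ss ih =>
    simp only [tcap] at h ⊢
    split_ifs with hu
    · exact inst_var _ _
    · rw [if_neg hu] at h
      obtain ⟨ts, rfl⟩ := h.exists_func
      rcases step_func_inv ht with ⟨ρ, hρ, γ, h1, _⟩ | ⟨i, u, hi, rfl⟩
      · obtain ⟨σ, hσ⟩ := h
        exact absurd ⟨ρ, hρ, σ, γ, hσ.symm.trans h1⟩ hu
      · rw [inst_capApp] at h ⊢
        intro j
        by_cases hj : j = i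
        · subst hj; simpa using ih j (h j) hi
        · simpa [hj] using h j

theorem Inst.tcap_steps {R : Set (Rule L V)} {s t t' : L.Term V} (h : Inst (tcap R s) t)
    (ht : Steps R t t') : Inst (tcap R s) t' := by
  induction ht with
  | refl => exact h
  | tail _ hbc ih => exact ih.tcap_step hbc

/-- This links actual reductions to the unification tests in both rule sets: `l` is a left-hand side
for usable rules and the pattern to be matched for formative rules. -/
theorem unifies_of_steps {R : Set (Rule L V)} {n : ℕ} {f : L.Functions n}
    {ts us : Fin n → L.Term V} {γ : V → L.Term V} {l : L.Term V} {τ : V → L.Term V}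
    (h : ∀ i, Steps R ((ts i).subst γ) (us i)) (hl : Term.func f us = l.subst τ) :
    Unifies (capApp f fun i => tcap R (ts i)) l := by
  have : Inst (capApp f fun i => tcap R (ts i)) (Term.func f us) :=
    inst_capApp.2 fun i => (inst_tcap_subst R (ts i) γ).tcap_steps (h i)
  obtain ⟨σ, hσ⟩ := this
  exact ⟨σ, τ, hσ.symm.trans hl⟩

/-! ### Argument filterings -/

theorem filterTerm_subst (π : ArgFiltering L) (t : L.Term V) (γ : V → L.Term W) :
    filterTerm π (t.subst γ) = (filterTerm π t).subst fun x => filterTerm π (γ x) := by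
  induction t with
  | var x => rfl
  | func f ts ih => simp [filterTerm, ih]

theorem ReductionPair.ge_func {L : FirstOrder.Language.{u, v}} (rp : ReductionPair L V) {n : ℕ}
    (f : L.Functions n) {ts us : Fin n → L.Term V} (h : ∀ i, rp.ge (ts i) (us i)) :
    rp.ge (Term.func f ts) (Term.func f us) :=
  congr_of_update (q := rp.ge) (r := rp.ge) rp.ge_refl rp.ge_trans (Term.func f)
    (fun ts i t => rp.ge_mono f ts i t) h

/-- The filtered sides of the rule are related by `≿`. -/
def Oriented {π : ArgFiltering L} (rp : ReductionPair (filteredLanguage π) V) (ρ : Rule L V) :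
    Prop :=
  rp.ge (filterTerm π ρ.lhs) (filterTerm π ρ.rhs)

variable {π : ArgFiltering L} {rp : ReductionPair (filteredLanguage π) V}

theorem Oriented.subst {ρ : Rule L V} (h : Oriented rp ρ) (γ : V → L.Term V) :
    rp.ge (filterTerm π (ρ.lhs.subst γ)) (filterTerm π (ρ.rhs.subst γ)) := by
  rw [filterTerm_subst, filterTerm_subst]
  exact rp.ge_stable _ _ _ h

theorem ge_filterTerm_func {n : ℕ} (f : L.Functions n) {ts us : Fin n → L.Term V}
    (h : ∀ i ∈ π n f, rp.ge (filterTerm π (ts i)) (filterTerm π (us i))) :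
    rp.ge (filterTerm π (Term.func f ts)) (filterTerm π (Term.func f us)) := by
  simp only [filterTerm]
  exact rp.ge_func _ fun j => h _ (Finset.orderEmbOfFin_mem _ _ _)

theorem ge_filterTerm_of_step {R : Set (Rule L V)} (hR : ∀ ρ ∈ R, Oriented rp ρ) {s t : L.Term V}
    (h : Step R s t) : rp.ge (filterTerm π s) (filterTerm π t) := by
  induction h with
  | root ρ γ hρ => exact (hR ρ hρ).subst γ
  | arg f ts i t _ ih =>
    refine ge_filterTerm_func f fun j _ => ?_
    by_cases hj : j = i
    · subst hj; simpa using ih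
    · simpa [hj] using rp.ge_refl _

theorem ge_filterTerm_of_steps {R : Set (Rule L V)} (hR : ∀ ρ ∈ R, Oriented rp ρ)
    {s t : L.Term V} (h : Steps R s t) : rp.ge (filterTerm π s) (filterTerm π t) := by
  induction h with
  | refl => exact rp.ge_refl _
  | tail _ hbc ih => exact rp.ge_trans _ _ _ ih (ge_filterTerm_of_step hR hbc)

end Basic

section Formative

variable {L : FirstOrder.Language.{u, v}} {V : Type w}

/-! ### Parallel rewriting -/

/-- One parallel rewrite step with the rules of `X`. -/
inductive Par (X : Set (Rule L V)) : L.Term V → L.Term V → Prop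
  | refl (s : L.Term V) : Par X s s
  | func {n : ℕ} (f : L.Functions n) (ts us : Fin n → L.Term V) :
      (∀ i, Par X (ts i) (us i)) → Par X (Term.func f ts) (Term.func f us)
  | root (ρ : Rule L V) (γ : V → L.Term V) : ρ ∈ X → Par X (ρ.lhs.subst γ) (ρ.rhs.subst γ)

/-- A sequence of `k` parallel rewrite steps. -/
def ParN (X : Set (Rule L V)) : ℕ → L.Term V → L.Term V → Prop
  | 0, s, t => s = t
  | k + 1, s, t => ∃ q, ParN X k s q ∧ Par X q t

variable {X : Set (Rule L V)}

theorem Par.func_inv {n : ℕ} {f : L.Functions n} {s : L.Term V} {us : Fin n → L.Term V}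
    (h : Par X s (Term.func f us)) :
    (∃ ts, s = Term.func f ts ∧ ∀ i, Par X (ts i) (us i)) ∨
      ∃ ρ ∈ X, ∃ γ : V → L.Term V, s = ρ.lhs.subst γ ∧ ρ.rhs.subst γ = Term.func f us := by
  generalize ht : Term.func f us = t at h
  cases h with
  | refl => exact Or.inl ⟨us, ht.symm, fun i => Par.refl _⟩
  | func g ts us' h' => cases ht; exact Or.inl ⟨ts, rfl, h'⟩
  | root ρ γ hρ => exact Or.inr ⟨ρ, hρ, γ, rfl, rfl⟩

theorem Par.of_step {s t : L.Term V} (h : Step X s t) : Par X s t := by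
  induction h with
  | root ρ γ hρ => exact Par.root ρ γ hρ
  | arg f ts i t _ ih =>
    refine Par.func f _ _ fun j => ?_
    by_cases hj : j = i
    · subst hj; simpa using ih
    · simpa [hj] using Par.refl _

theorem ParN.refl (k : ℕ) (s : L.Term V) : ParN X k s s := by
  induction k with
  | zero => rfl
  | succ k ih => exact ⟨s, ih, Par.refl s⟩

theorem ParN.trans {a b : ℕ} {s q t : L.Term V} (h : ParN X a s q) (h' : ParN X b q t) :
    ParN X (a + b) s t := by
  induction b generalizing t with
  | zero => cases h'; exact h
  | succ b ih =>
    obtain ⟨p, hp, hpt⟩ := h'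
    exact ⟨p, ih hp, hpt⟩

theorem ParN.mono {a b : ℕ} (hab : a ≤ b) {s t : L.Term V} (h : ParN X a s t) : ParN X b s t := by
  obtain ⟨c, rfl⟩ := Nat.exists_eq_add_of_le hab
  exact h.trans (ParN.refl c t)

theorem exists_parN {s t : L.Term V} (h : Steps X s t) : ∃ k, ParN X k s t := by
  induction h with
  | refl => exact ⟨0, rfl⟩
  | tail _ hbc ih =>
    obtain ⟨k, hk⟩ := ih
    exact ⟨k + 1, _, hk, Par.of_step hbc⟩

theorem ParN.func {k n : ℕ} (f : L.Functions n) {ts us : Fin n → L.Term V}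
    (h : ∀ i, ParN X k (ts i) (us i)) : ParN X k (Term.func f ts) (Term.func f us) := by
  induction k generalizing us with
  | zero => exact congrArg _ (funext h)
  | succ k ih =>
    choose q hq hqu using h
    exact ⟨Term.func f q, ih hq, Par.func f _ _ hqu⟩

/-- The reason for counting parallel steps: the bound `k` does not grow with the number of
occurrences of a variable in `t`, so duplicating right-hand sides do no harm. -/
theorem ParN.subst {k : ℕ} (t : L.Term V) {δ γ : V → L.Term V} (h : ∀ x, ParN X k (δ x) (γ x)) :
    ParN X k (t.subst δ) (t.subst γ) := by
  induction t with
  | var x => exact h x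
  | func f ts ih => exact ParN.func f ih

/-- A sequence of parallel steps either has no step at the root, or can be split at the last such
step. -/
theorem ParN.func_inv {k n : ℕ} {f : L.Functions n} {s : L.Term V} {ts : Fin n → L.Term V}
    (h : ParN X k s (Term.func f ts)) :
    (∃ ss, s = Term.func f ss ∧ ∀ i, ParN X k (ss i) (ts i)) ∨
      ∃ a b, a + 1 + b = k ∧ ∃ ρ ∈ X, ∃ (γ : V → L.Term V) (us : Fin n → L.Term V),
        ParN X a s (ρ.lhs.subst γ) ∧ ρ.rhs.subst γ = Term.func f us ∧
          ∀ i, ParN X b (us i) (ts i) := by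
  induction k generalizing ts with
  | zero => exact Or.inl ⟨ts, h, fun i => rfl⟩
  | succ k ih =>
    obtain ⟨q, hq, hqt⟩ := h
    rcases hqt.func_inv with ⟨qs, rfl, hqs⟩ | ⟨ρ, hρ, γ, rfl, hr⟩
    · rcases ih hq with ⟨ss, rfl, hss⟩ | ⟨a, b, rfl, ρ, hρ, γ, us, h1, h2, h3⟩
      · exact Or.inl ⟨ss, rfl, fun i => ⟨_, hss i, hqs i⟩⟩
      · exact Or.inr ⟨a, b + 1, rfl, ρ, hρ, γ, us, h1, h2, fun i => ⟨_, h3 i, hqs i⟩⟩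
    · exact Or.inr ⟨k, 0, rfl, ρ, hρ, γ, ts, hq, hr, fun i => rfl⟩

/-- In an infinite sequence of decreases, only finitely many are strict. -/
theorem ReductionPair.eventually_not_strict {L : FirstOrder.Language.{u, v}}
    (rp : ReductionPair L V) {a b : ℕ → L.Term V} {G : ℕ → Prop}
    (hgt : ∀ i, G i → rp.gt (a i) (b i)) (hge : ∀ i, ¬ G i → rp.ge (a i) (b i))
    (hba : ∀ i, rp.ge (b i) (a (i + 1))) : ∃ n, ∀ i, n ≤ i → ¬ G i := by
  by_contra hcon
  push Not at hcon
  -- Since `≿` is absorbed by `≻` only on the right, the comparison has to start at a strict index.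
  have hdec : ∀ i, G i → ∀ j, i < j → rp.gt (a i) (a j) := by
    intro i hi j hij
    induction j, hij using Nat.le_induction with
    | base => exact rp.gt_ge _ _ _ (hgt i hi) (hba i)
    | succ j _ ih =>
      by_cases hj : G j
      · exact rp.gt_ge _ _ _ (rp.gt_trans _ _ _ ih (hgt j hj)) (hba j)
      · exact rp.gt_ge _ _ _ (rp.gt_ge _ _ _ ih (hge j hj)) (hba j)
  obtain ⟨φ, hφ, hG⟩ := Filter.extraction_of_frequently_atTop
    (Filter.frequently_atTop.2 fun n => (hcon n).imp fun i hi => ⟨hi.1, hi.2⟩)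
  exact (wellFounded_iff_isEmpty_descending_chain.1 rp.gt_wf).false
    ⟨fun n => a (φ n), fun n => hdec _ (hG n) _ (hφ (Nat.lt_succ_self n))⟩

/-! ### Combined rules -/

variable [Infinite V] {U : Set (Rule L V)}

/-- The left-hand side is not a variable and contains all variables of the right-hand side. -/
def ProperRule (ρ : Rule L V) : Prop := ¬ IsVar ρ.lhs ∧ vars ρ.rhs ⊆ vars ρ.lhs

theorem properRule_projRule {n : ℕ} (f : L.Functions n) (i : Fin n) :
    ProperRule (projRule (V := V) f i) := by
  constructor
  · rintro ⟨x, hx⟩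
    cases hx
  · exact fun x hx => mem_vars_func.2 ⟨i, hx⟩

theorem Combined.properRule (hU : ∀ ρ ∈ U, ProperRule ρ) {ρ : Rule L V} (h : Combined U ρ) :
    ProperRule ρ := by
  induction h with
  | base ρ hρ => exact hU ρ hρ
  | split => exact properRule_projRule _ _
  | combine l f rs i _ _ ih _ =>
    exact ⟨ih.1, fun x hx => ih.2 (mem_vars_func.2 ⟨i, hx⟩)⟩

theorem exists_subst_projRule {n : ℕ} (f : L.Functions n) (i : Fin n) (ts : Fin n → L.Term V) :
    ∃ γ : V → L.Term V, (projRule f i).lhs.subst γ = Term.func f ts ∧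
      (projRule f i).rhs.subst γ = ts i := by
  classical
  have hinj : Function.Injective fun j : Fin n => stdVar V j := fun a b h =>
    Fin.ext ((Infinite.natEmbedding V).injective h)
  refine ⟨Function.extend (fun j : Fin n => stdVar V j) ts Term.var, ?_, ?_⟩
  · simp only [projRule, subst_func, subst_var]
    congr 1
    ext j
    exact hinj.extend_apply ts _ j
  · exact hinj.extend_apply ts _ i

/-- A root step with a rule `f(x₁,…,xₙ) → xᵢ` among the combined rules of `U`. -/
inductive Proj (U : Set (Rule L V)) : L.Term V → L.Term V → Prop
  | mk {n : ℕ} (f : L.Functions n) (i : Fin n) (ts : Fin n → L.Term V) :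
      Combined U (projRule f i) → Proj U (Term.func f ts) (ts i)

theorem projRule_mem_combinedRules {n : ℕ} {f : L.Functions n} {i : Fin n}
    (h : Combined U (projRule f i)) : projRule f i ∈ combinedRules U :=
  ⟨h, Or.inl ⟨n, f, i, rfl⟩⟩

theorem Proj.step {s t : L.Term V} (h : Proj U s t) : Step (combinedRules U) s t := by
  obtain ⟨f, i, ts, hf⟩ := h
  obtain ⟨γ, h1, h2⟩ := exists_subst_projRule f i ts
  have := Step.root (R := combinedRules U) _ γ (projRule_mem_combinedRules hf)
  rwa [h1, h2] at this

/-- The effect of a collapsing rule is obtained by projections. -/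
theorem Combined.projs (hU : ∀ ρ ∈ U, ProperRule ρ) {ρ : Rule L V} (h : Combined U ρ) {x : V}
    (hx : ρ.rhs = Term.var x) (γ : V → L.Term V) :
    Relation.ReflTransGen (Proj U) (ρ.lhs.subst γ) (γ x) := by
  -- Walk from the root of the left-hand side down to an occurrence of `x`; each symbol on the path
  -- contributes one projection, which `Combined.split` puts into the closure.
  have key : ∀ u t : L.Term V, Subterm u t → Subterm ρ.lhs u → t = Term.var x →
      Relation.ReflTransGen (Proj U) (u.subst γ) (γ x) := by
    intro u t hut
    induction hut with
    | refl s => rintro - rfl; exact Relation.ReflTransGen.refl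
    | arg f ts i t hit ih =>
      rintro hl rfl
      refine Relation.ReflTransGen.head (Proj.mk f i (fun j => (ts j).subst γ) ?_) (ih ?_ rfl)
      · exact Combined.split ρ f ts i h ⟨x, hx⟩ hl (hx ▸ hit)
      · exact hl.trans (Subterm.arg f ts i _ (Subterm.refl _))
  refine key ρ.lhs _ ?_ (Subterm.refl _) rfl
  exact (h.properRule hU).2 (hx ▸ mem_vars_var.2 rfl)

theorem mem_combinedRules_of_func {ρ : Rule L V} (h : Combined U ρ) {n : ℕ} {f : L.Functions n}
    {rs : Fin n → L.Term V} (hr : ρ.rhs = Term.func f rs) : ρ ∈ combinedRules U :=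
  ⟨h, Or.inr fun ⟨x, hx⟩ => by rw [hr] at hx; cases hx⟩

/-- The closure may contain collapsing rules that are absent from `combinedRules U`; projections
simulate them. -/
theorem steps_of_par (hU : ∀ ρ ∈ U, ProperRule ρ) {s t : L.Term V}
    (h : Par {ρ | Combined U ρ} s t) : Steps (combinedRules U) s t := by
  induction h with
  | refl => exact Relation.ReflTransGen.refl
  | func f ts us _ ih => exact Steps.func f ih
  | root ρ γ hρ =>
    rcases hr : ρ.rhs with x | ⟨f, rs⟩
    · exact Relation.ReflTransGen.mono (fun _ _ => Proj.step) _ _ (Combined.projs hU hρ hr γ)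
    · rw [← hr]
      exact Relation.ReflTransGen.single (Step.root ρ γ (mem_combinedRules_of_func hρ hr))

theorem steps_of_parN (hU : ∀ ρ ∈ U, ProperRule ρ) {k : ℕ} {s t : L.Term V}
    (h : ParN {ρ | Combined U ρ} k s t) : Steps (combinedRules U) s t := by
  induction k generalizing t with
  | zero => cases h; exact Relation.ReflTransGen.refl
  | succ k ih =>
    obtain ⟨q, hq, hqt⟩ := h
    exact (ih hq).trans (steps_of_par hU hqt)

/-- Projections can be moved before parallel steps with combined rules. -/
theorem exists_projs_parN (hU : ∀ ρ ∈ U, ProperRule ρ) (k : ℕ) {s q t : L.Term V}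
    (h : ParN {ρ | Combined U ρ} k s q) (hqt : Relation.ReflTransGen (Proj U) q t) :
    ∃ u, Relation.ReflTransGen (Proj U) s u ∧ ParN {ρ | Combined U ρ} k u t := by
  induction k using Nat.strong_induction_on generalizing s q t with
  | _ k IH =>
    induction hqt with
    | refl => exact ⟨s, Relation.ReflTransGen.refl, h⟩
    | @tail b c _ hbc ih =>
      obtain ⟨p, hsp, hpb⟩ := ih
      suffices ∃ u, Relation.ReflTransGen (Proj U) p u ∧ ParN {ρ | Combined U ρ} k u c by
        obtain ⟨u, hpu, huc⟩ := this
        exact ⟨u, hsp.trans hpu, huc⟩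
      obtain ⟨f, i, ts, hf⟩ := hbc
      rcases hpb.func_inv with ⟨ss, rfl, hss⟩ | ⟨a, b, rfl, ρ, hρ, γ, us, h1, h2, h3⟩
      -- Without a root step, the projection can be done at the start, and the `i`-th argument makes
      -- the `k` steps alone.
      · exact ⟨ss i, Relation.ReflTransGen.single (Proj.mk f i ss hf), hss i⟩
      · rcases hr : ρ.rhs with x | ⟨g, rs⟩
        · have hp := Combined.projs hU hρ hr γ
          rw [hr, subst_var] at h2
          rw [h2] at hp
          -- A collapsing root step is itself a sequence of projections; with the new projection
          -- appended, it follows only `a` parallel steps.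
          obtain ⟨u, hpu, hu⟩ := IH a (by omega) h1 (hp.tail (Proj.mk f i us hf))
          exact ⟨u, hpu, (hu.trans (h3 i)).mono (by omega)⟩
        · rw [hr, subst_func] at h2
          cases h2
          -- A non-collapsing root step absorbs the projection: the combined rule needs a single
          -- step, so the count stays `a + 1 + b`.
          have hc : Combined U ⟨ρ.lhs, rs i⟩ := by
            refine Combined.combine ρ.lhs f rs i ?_ hf
            rw [← hr]
            exact hρ
          refine ⟨p, Relation.ReflTransGen.refl, ?_⟩
          exact ParN.trans (a := a + 1) ⟨_, h1, Par.root ⟨ρ.lhs, rs i⟩ γ hc⟩ (h3 i)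

/-! ### Formative reductions -/

variable {π : ArgFiltering L} {rp : ReductionPair (filteredLanguage π) V}

/-- Projections are collapsing rules of `combinedRules U`, hence split-formative for every term. -/
theorem ge_filterTerm_of_projs {l : L.Term V}
    (ho : ∀ ρ, SplitFormativeT (combinedRules U) π l ρ → Oriented rp ρ) {s t : L.Term V}
    (h : Relation.ReflTransGen (Proj U) s t) : rp.ge (filterTerm π s) (filterTerm π t) := by
  induction h with
  | refl => exact rp.ge_refl _
  | tail _ hbc ih =>
    refine rp.ge_trans _ _ _ ih ?_
    obtain ⟨f, i, ts, hf⟩ := hbc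
    obtain ⟨γ, h1, h2⟩ := exists_subst_projRule f i ts
    rw [← h1, ← h2]
    exact (ho _ (SplitFormativeT.collapsing l _ (projRule_mem_combinedRules hf) ⟨_, rfl⟩)).subst γ

/-- A reduction to an instance `lγ` gives a decrease with respect to `≿` to some `lδ`, where `δ`
reduces to `γ`, if the split-formative rules of `l` are oriented. -/
theorem exists_ge_filterTerm (hU : ∀ ρ ∈ U, ProperRule ρ) (N : ℕ) (l : L.Term V) {s : L.Term V}
    {γ : V → L.Term V} (ho : ∀ ρ, SplitFormativeT (combinedRules U) π l ρ → Oriented rp ρ)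
    (h : ParN {ρ | Combined U ρ} N s (l.subst γ)) :
    ∃ δ : V → L.Term V, (∀ x, ParN {ρ | Combined U ρ} N (δ x) (γ x)) ∧
      rp.ge (filterTerm π s) (filterTerm π (l.subst δ)) := by
  classical
  -- The number of steps comes first and the pattern second, because passing to the left-hand side
  -- of a rule may enlarge the pattern but uses up a step.
  induction N using Nat.strong_induction_on generalizing l s γ with
  | _ N IH =>
    induction l generalizing s γ with
    | var x =>
      refine ⟨Function.update γ x s, fun y => ?_, ?_⟩
      · by_cases hy : y = x
        · subst hy; simpa using h
        · simpa [hy] using ParN.refl N (γ y)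
      · simpa using rp.ge_refl _
    | @func n f ls ihl =>
      by_cases hlin : Linear (Term.func f ls)
      swap
      -- For a non-linear pattern all combined rules are oriented, so nothing is postponed.
      · exact ⟨γ, fun x => ParN.refl N _,
          ge_filterTerm_of_steps (fun ρ hρ => ho ρ (SplitFormativeT.nonlinear _ ρ hlin hρ))
            (steps_of_parN hU h)⟩
      rw [subst_func] at h
      rcases h.func_inv with ⟨ss, rfl, hss⟩ | ⟨a, b, rfl, ρ, hρ, γ', us, h1, h2, h3⟩
      · have hi : ∀ i, ∃ δ : V → L.Term V, (∀ x, ParN {ρ | Combined U ρ} N (δ x) (γ x)) ∧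
            (i ∈ π n f → rp.ge (filterTerm π (ss i)) (filterTerm π ((ls i).subst δ))) := by
          intro i
          by_cases hi : i ∈ π n f
          · obtain ⟨δ, h1, h2⟩ :=
              ihl i (fun ρ hρ => ho ρ (SplitFormativeT.arg f ls i ρ hi hρ)) (hss i)
            exact ⟨δ, h1, fun _ => h2⟩
          -- A filtered argument needs no comparison, so its rules need not be oriented.
          · exact ⟨γ, fun x => ParN.refl N _, fun h => absurd h hi⟩
        choose δ hδ1 hδ2 using hi
        -- By linearity each variable lies in at most one argument, so the substitutions can be
        -- merged.
        refine ⟨fun x => if hx : ∃ i, x ∈ vars (ls i) then δ hx.choose x else γ x,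
          fun x => ?_, ?_⟩
        · beta_reduce
          split_ifs with hx
          · exact hδ1 _ x
          · exact ParN.refl N _
        · rw [subst_func]
          refine ge_filterTerm_func f fun i hif => ?_
          have hc : ∀ x ∈ vars (ls i), δ i x =
              if hx : ∃ i, x ∈ vars (ls i) then δ hx.choose x else γ x := by
            intro x hx
            have hx' : ∃ i, x ∈ vars (ls i) := ⟨i, hx⟩
            rw [dif_pos hx', hlin.disjoint hx'.choose_spec hx]
          rw [← subst_congr hc]
          exact hδ2 i hif
      · rcases hr : ρ.rhs with x | ⟨g, rs⟩
        · have hp := Combined.projs hU hρ hr γ'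
          rw [hr, subst_var] at h2
          rw [h2] at hp
          -- The collapsing step turns into initial projections, which are oriented; `a + b`
          -- parallel steps are left.
          obtain ⟨u, hsu, hu⟩ := exists_projs_parN hU a h1 hp
          obtain ⟨δ, hδ, hge⟩ := IH (a + b) (by omega) (Term.func f ls) (γ := γ) ho
            (hu.trans (ParN.func f h3))
          exact ⟨δ, fun x => (hδ x).mono (by omega),
            rp.ge_trans _ _ _ (ge_filterTerm_of_projs ho hsu) hge⟩
        · have hA := mem_combinedRules_of_func hρ hr
          have h2' := h2
          rw [hr, subst_func] at h2'
          cases h2'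
          have hs : SplitFormativeT (combinedRules U) π (Term.func f ls) ρ :=
            SplitFormativeT.cap f ls rs ρ hA hr
              (unifies_of_steps (fun i => steps_of_parN hU (h3 i)) rfl)
          have hnv : ¬ IsVar ρ.rhs := fun ⟨x, hx⟩ => by rw [hr] at hx; cases hx
          -- The `a` steps before the root step are reorganised towards `ρ.lhs`. Then `ρ` is applied
          -- with `δ'`, and the steps postponed into `δ'` are done after it, which again leaves `a +
          -- b` steps to `lγ`.
          obtain ⟨δ', hδ', hge'⟩ := IH a (by omega) ρ.lhs (γ := γ')
            (fun ρ' hρ' => ho ρ' (SplitFormativeT.lhs _ ρ ρ' hs hnv hρ')) h1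
          have h4 : ParN {ρ | Combined U ρ} (a + b) (ρ.rhs.subst δ')
              ((Term.func f ls).subst γ) := by
            refine (ParN.subst ρ.rhs hδ').trans ?_
            rw [h2]
            exact ParN.func f h3
          obtain ⟨δ, hδ, hge⟩ := IH (a + b) (by omega) (Term.func f ls) (γ := γ) ho h4
          exact ⟨δ, fun x => (hδ x).mono (by omega), rp.ge_trans _ _ _ hge'
            (rp.ge_trans _ _ _ ((ho ρ hs).subst δ') hge)⟩

/-- If the split-formative rules of the pairs in a chain are oriented, then only finitely many pairs
of the chain are strictly oriented. -/
theorem eventually_not_strict_of_chain (hU : ∀ ρ ∈ U, ProperRule ρ) {ρ : ℕ → Rule L V}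
    {γ : ℕ → V → L.Term V} {G : ℕ → Prop}
    (hc : ∀ i, Steps U ((ρ i).rhs.subst (γ i)) ((ρ (i + 1)).lhs.subst (γ (i + 1))))
    (ho : ∀ i ρ', SplitFormativeT (combinedRules U) π (ρ i).lhs ρ' → Oriented rp ρ')
    (hgt : ∀ i, G i → rp.gt (filterTerm π (ρ i).lhs) (filterTerm π (ρ i).rhs))
    (hge : ∀ i, ¬ G i → Oriented rp (ρ i)) : ∃ n, ∀ i, n ≤ i → ¬ G i := by
  -- The bound `N` is uniform in `x`, so that `ParN.subst` can place the postponed steps before the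
  -- next connecting reduction.
  let Q : ℕ → (V → L.Term V) → Prop := fun i δ =>
    ∃ N, ∀ x, ParN {ρ | Combined U ρ} N (δ x) (γ i x)
  have hnext : ∀ i (δ : {δ // Q i δ}), ∃ δ' : {δ // Q (i + 1) δ},
      rp.ge (filterTerm π ((ρ i).rhs.subst δ.1)) (filterTerm π ((ρ (i + 1)).lhs.subst δ'.1)) := by
    rintro i ⟨δ, N, hN⟩
    obtain ⟨k, hk⟩ := exists_parN (X := {ρ | Combined U ρ})
      (Steps.mono (fun ρ hρ => Combined.base ρ hρ) (hc i))
    obtain ⟨δ', h1, h2⟩ := exists_ge_filterTerm hU (N + k) (ρ (i + 1)).lhs (ho (i + 1))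
      ((ParN.subst (ρ i).rhs hN).trans hk)
    exact ⟨⟨δ', _, h1⟩, h2⟩
  choose next hnext using hnext
  let δ : ∀ i, {δ // Q i δ} := fun i =>
    Nat.rec (motive := fun i => {δ // Q i δ}) ⟨γ 0, 0, fun _ => rfl⟩ next i
  refine rp.eventually_not_strict (a := fun i => filterTerm π ((ρ i).lhs.subst (δ i).1))
    (b := fun i => filterTerm π ((ρ i).rhs.subst (δ i).1)) (fun i hi => ?_)
    (fun i hi => (hge i hi).subst _) fun i => hnext i (δ i)
  rw [filterTerm_subst, filterTerm_subst]
  exact rp.gt_stable _ _ _ (hgt i hi)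

end Formative

/-! ### Termination and the well-founded order behind the interpretation. -/

section Terminating

variable {L : FirstOrder.Language.{u, v}} {V : Type w} {R : Set (Rule L V)}

theorem terminating_iff_acc {s : L.Term V} :
    Terminating R s ↔ Acc (fun t s => Step R s t) s := by
  rw [← not_iff_not, not_acc_iff_exists_descending_chain, Terminating, not_not]

theorem Terminating.step {s t : L.Term V} (h : Terminating R s) (hst : Step R s t) :
    Terminating R t :=
  terminating_iff_acc.2 ((terminating_iff_acc.1 h).inv hst)

theorem Terminating.steps {s t : L.Term V} (h : Terminating R s) (hst : Steps R s t) :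
    Terminating R t := by
  induction hst with
  | refl => exact h
  | tail _ hbc ih => exact ih.step hbc

theorem Subterm.exists_step {s t t' : L.Term V} (h : Subterm s t) (ht : Step R t t') :
    ∃ s', Step R s s' ∧ Subterm s' t' := by
  induction h with
  | refl => exact ⟨t', ht, Subterm.refl _⟩
  | arg f ts i t _ ih =>
    obtain ⟨s', h1, h2⟩ := ih ht
    exact ⟨_, Step.arg f ts i s' h1, Subterm.arg f _ i _ (by simpa using h2)⟩

theorem Terminating.subterm {s t : L.Term V} (h : Terminating R s) (hst : Subterm s t) :
    Terminating R t := by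
  rw [terminating_iff_acc] at h ⊢
  induction h generalizing t with
  | intro s _ ih =>
    refine Acc.intro _ fun t' ht => ?_
    obtain ⟨s', h1, h2⟩ := hst.exists_step ht
    exact ih s' h1 h2

theorem Terminating.arg {n : ℕ} {f : L.Functions n} {ts : Fin n → L.Term V}
    (h : Terminating R (Term.func f ts)) (i : Fin n) : Terminating R (ts i) :=
  h.subterm (Subterm.arg f ts i _ (Subterm.refl _))

/-- `s` is a direct reduct or an argument of the terminating term `t`. -/
def Smaller (R : Set (Rule L V)) (s t : L.Term V) : Prop :=
  Terminating R t ∧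
    (Step R t s ∨ ∃ (n : ℕ) (f : L.Functions n) (ts : Fin n → L.Term V) (i : Fin n),
      t = Term.func f ts ∧ s = ts i)

/-- For terminating `t`, all subterms of `t` are handled at once: a step in a subterm lifts to a
step of `t`, and taking an argument stays among the subterms. A non-terminating term has nothing
below it, so the relation is well-founded on all terms. -/
theorem wellFounded_smaller (R : Set (Rule L V)) : WellFounded (Smaller R) := by
  have key : ∀ t, Acc (fun t s => Step R s t) t → ∀ u, Subterm t u → Acc (Smaller R) u := by
    intro t ht
    induction ht with
    | intro t _ ih =>
      intro u hu
      have hred : ∀ u', Step R u u' → Acc (Smaller R) u' := fun u' h => by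
        obtain ⟨t', h1, h2⟩ := hu.exists_step h
        exact ih t' h1 u' h2
      induction u with
      | var x =>
        refine Acc.intro _ fun s hs => ?_
        rcases hs.2 with h | ⟨n, f, ts, i, h, _⟩
        · exact hred s h
        · cases h
      | func f us ihu =>
        refine Acc.intro _ fun s hs => ?_
        rcases hs.2 with h | ⟨n, g, ts, i, h, rfl⟩
        · exact hred s h
        · cases h
          have hi : Subterm t (us i) := hu.trans (Subterm.arg f us i _ (Subterm.refl _))
          refine ihu i hi fun u' h' => ?_
          obtain ⟨t', h1, h2⟩ := hi.exists_step h'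
          exact ih t' h1 u' h2
  refine ⟨fun t => ?_⟩
  by_cases ht : Terminating R t
  · exact key t (terminating_iff_acc.1 ht) t (Subterm.refl _)
  · exact Acc.intro _ fun s hs => absurd hs.1 ht

theorem smaller_arg {n : ℕ} {f : L.Functions n} {ts : Fin n → L.Term V}
    (h : Terminating R (Term.func f ts)) (i : Fin n) : Smaller R (ts i) (Term.func f ts) :=
  ⟨h, Or.inr ⟨n, f, ts, i, rfl, rfl⟩⟩

end Terminating

/-! ### Transfer to the signature with `c`. -/

section LanguageMap

variable {L : FirstOrder.Language.{u, v}} {V : Type w}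

theorem onTerm_subst {L' : FirstOrder.Language} (φ : L →ᴸ L') (t : L.Term V)
    (γ : V → L.Term V) : φ.onTerm (t.subst γ) = (φ.onTerm t).subst fun x => φ.onTerm (γ x) := by
  induction t with
  | var x => rfl
  | func f ts ih => simp [LHom.onTerm, ih]

theorem vars_onTerm {L' : FirstOrder.Language} (φ : L →ᴸ L') (t : L.Term V) :
    vars (φ.onTerm t) = vars t := by
  ext x
  induction t with
  | var y => simp only [LHom.onTerm, mem_vars_var]
  | func f ts ih => simp only [LHom.onTerm, mem_vars_func, ih]

theorem Step.toC {R : Set (Rule L V)} {s t : L.Term V} (h : Step R s t) :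
    Step (Rule.toC '' R) ((LHom.sumInl : L →ᴸ withC L).onTerm s)
      ((LHom.sumInl : L →ᴸ withC L).onTerm t) := by
  induction h with
  | root ρ γ hρ =>
    rw [onTerm_subst, onTerm_subst]
    exact Step.root ρ.toC _ ⟨ρ, hρ, rfl⟩
  | arg f ts i t _ ih =>
    have := Step.arg (R := Rule.toC '' R) ((LHom.sumInl : L →ᴸ withC L).onFunction f)
      (fun j => LHom.sumInl.onTerm (ts j)) i _ ih
    convert this using 1
    simp only [LHom.onTerm]
    refine congrArg (Term.func _) (funext fun j => ?_)
    by_cases hj : j = i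
    · subst hj; simp
    · simp [hj]

theorem Steps.toC {R : Set (Rule L V)} {s t : L.Term V} (h : Steps R s t) :
    Steps (Rule.toC '' R) ((LHom.sumInl : L →ᴸ withC L).onTerm s)
      ((LHom.sumInl : L →ᴸ withC L).onTerm t) := by
  induction h with
  | refl => exact Relation.ReflTransGen.refl
  | tail _ hbc ih => exact ih.tail hbc.toC

theorem properRule_toC {ρ : Rule L V} (h1 : ¬ IsVar ρ.lhs) (h2 : vars ρ.rhs ⊆ vars ρ.lhs) :
    ProperRule ρ.toC := by
  refine ⟨?_, ?_⟩
  · rintro ⟨x, hx⟩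
    rcases hl : ρ.lhs with y | ⟨f, ts⟩
    · exact h1 ⟨y, hl⟩
    · simp only [Rule.toC, hl, LHom.onTerm] at hx
      cases hx
  · simpa only [Rule.toC, vars_onTerm] using h2

theorem UsableT.mem {R : Set (Rule L V)} {π : ArgFiltering L} {t : L.Term V} {ρ : Rule L V} (h : UsableT R π t ρ) :
    ρ ∈ R := by
  induction h with
  | infinite _ _ _ h => exact h
  | arg _ _ _ _ _ _ ih => exact ih
  | cap _ _ _ h => exact h
  | rhs _ _ _ _ _ _ ih => exact ih

end LanguageMap

/-! ### Usable rules -/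

section Usable

variable {L : FirstOrder.Language.{u, v}} {V : Type w} {R U : Set (Rule L V)}

/-- No rule of `R \ U` can be applied at the root after steps in the arguments. -/
def Safe (R U : Set (Rule L V)) {n : ℕ} (f : L.Functions n) (ts : Fin n → L.Term V) : Prop :=
  ∀ ss : Fin n → L.Term V, (∀ i, Steps R (ts i) (ss i)) → ∀ ρ ∈ R, ρ ∉ U →
    ∀ γ : V → L.Term V, Term.func f ss ≠ ρ.lhs.subst γ

theorem Safe.update {n : ℕ} {f : L.Functions n} {ts : Fin n → L.Term V} (h : Safe R U f ts)
    {i : Fin n} {t : L.Term V} (ht : Step R (ts i) t) : Safe R U f (Function.update ts i t) := by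
  refine fun ss hss => h ss fun j => ?_
  by_cases hj : j = i
  · subst hj
    have := hss j
    rw [Function.update_self] at this
    exact Relation.ReflTransGen.head ht this
  · simpa [hj] using hss j

/-- The term `c(s, t)`. -/
def cTerm (s t : (withC L).Term V) : (withC L).Term V :=
  Term.func (L := withC L) (l := 2) (Sum.inr CSymbol.c) ![s, t]

variable [Infinite V]

/-- The list `ts`, coded with the symbol `c`. -/
noncomputable def comb (ts : List ((withC L).Term V)) : (withC L).Term V :=
  ts.foldr cTerm (Term.var (stdVar V 0))

theorem step_cTerm_left (s t : (withC L).Term V) : Step (cEpsilon L V) (cTerm s t) s := by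
  obtain ⟨γ, h1, h2⟩ := exists_subst_projRule (V := V) (L := withC L) (n := 2)
    (Sum.inr CSymbol.c) 0 ![s, t]
  have := Step.root (R := cEpsilon L V) _ γ ⟨0, rfl⟩
  rwa [h1, h2] at this

theorem step_cTerm_right (s t : (withC L).Term V) : Step (cEpsilon L V) (cTerm s t) t := by
  obtain ⟨γ, h1, h2⟩ := exists_subst_projRule (V := V) (L := withC L) (n := 2)
    (Sum.inr CSymbol.c) 1 ![s, t]
  have := Step.root (R := cEpsilon L V) _ γ ⟨1, rfl⟩
  rwa [h1, h2] at this

theorem steps_comb {ts : List ((withC L).Term V)} {t : (withC L).Term V} (h : t ∈ ts) :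
    Steps (cEpsilon L V) (comb ts) t := by
  induction ts with
  | nil => cases h
  | cons a ts ih =>
    rcases List.mem_cons.1 h with rfl | h
    · exact Relation.ReflTransGen.single (step_cTerm_left _ _)
    · exact (Relation.ReflTransGen.single (step_cTerm_right _ _)).trans (ih h)

open Classical in
/-- The interpretation of terms that codes the reducts of a terminating term that is not safe in a
list. -/
noncomputable def interp (R U : Set (Rule L V)) (hb : FinitelyBranching R) :
    L.Term V → (withC L).Term V :=
  (wellFounded_smaller R).fix fun t ih =>
    match t, ih with
    | Term.var x, _ => Term.var x
    | Term.func f ts, ih =>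
      let t' : (withC L).Term V := Term.func (L := withC L) (Sum.inl f) fun i =>
        -- For a terminating term this test and the one for reducts below always succeed; the
        -- default is a junk value for non-terminating terms.
        if h : Smaller R (ts i) (Term.func f ts) then ih (ts i) h else Term.var (stdVar V 0)
      if Safe R U f ts then t'
      else comb (t' :: (hb (Term.func f ts)).toFinset.toList.map fun s =>
        if h : Smaller R s (Term.func f ts) then ih s h else Term.var (stdVar V 0))

variable {hb : FinitelyBranching R}

open Classical in
theorem interp_func {n : ℕ} {f : L.Functions n} {ts : Fin n → L.Term V}
    (ht : Terminating R (Term.func f ts)) :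
    interp R U hb (Term.func f ts) =
      if Safe R U f ts then Term.func (L := withC L) (Sum.inl f) fun i => interp R U hb (ts i)
      else comb ((Term.func (L := withC L) (Sum.inl f) fun i => interp R U hb (ts i)) ::
        (hb (Term.func f ts)).toFinset.toList.map (interp R U hb)) := by
  have h1 : (fun i => if _ : Smaller R (ts i) (Term.func f ts) then interp R U hb (ts i)
      else Term.var (stdVar V 0)) = fun i => interp R U hb (ts i) :=
    funext fun i => dif_pos (smaller_arg ht i)
  have h2 : ((hb (Term.func f ts)).toFinset.toList.map fun s =>
      if _ : Smaller R s (Term.func f ts) then interp R U hb s else Term.var (stdVar V 0)) =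
      (hb (Term.func f ts)).toFinset.toList.map (interp R U hb) :=
    List.map_congr_left fun s hs => dif_pos ⟨ht, Or.inl (by simpa using hs)⟩
  rw [← h1, ← h2]
  conv_lhs => rw [interp, WellFounded.fix_eq]
  rfl

theorem interp_func_of_safe {n : ℕ} {f : L.Functions n} {ts : Fin n → L.Term V}
    (ht : Terminating R (Term.func f ts)) (hs : Safe R U f ts) :
    interp R U hb (Term.func f ts) =
      Term.func (L := withC L) (Sum.inl f) fun i => interp R U hb (ts i) := by
  rw [interp_func ht, if_pos hs]

theorem steps_interp_func {n : ℕ} {f : L.Functions n} {ts : Fin n → L.Term V}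
    (ht : Terminating R (Term.func f ts)) :
    Steps (cEpsilon L V) (interp R U hb (Term.func f ts))
      (Term.func (L := withC L) (Sum.inl f) fun i => interp R U hb (ts i)) := by
  rw [interp_func ht]
  split_ifs
  · exact Relation.ReflTransGen.refl
  · exact steps_comb List.mem_cons_self

theorem steps_interp_reduct {n : ℕ} {f : L.Functions n} {ts : Fin n → L.Term V} {t : L.Term V}
    (ht : Terminating R (Term.func f ts)) (hs : ¬ Safe R U f ts) (h : Step R (Term.func f ts) t) :
    Steps (cEpsilon L V) (interp R U hb (Term.func f ts)) (interp R U hb t) := by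
  rw [interp_func ht, if_neg hs]
  exact steps_comb (List.mem_cons_of_mem _ (List.mem_map_of_mem (by simpa using h)))

/-- Wherever a symbol of `t` has been coded as a list, `C_ε` selects the head. This is the direction
needed for left-hand sides, about which nothing usable is known. -/
theorem steps_interp_subst (t : L.Term V) (γ : V → L.Term V) (ht : Terminating R (t.subst γ)) :
    Steps (cEpsilon L V) (interp R U hb (t.subst γ))
      (((LHom.sumInl : L →ᴸ withC L).onTerm t).subst fun x => interp R U hb (γ x)) := by
  induction t with
  | var x => exact Relation.ReflTransGen.refl
  | func f ts ih =>
    exact (steps_interp_func ht).trans (Steps.func _ fun i => ih i (ht.arg i))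

/-- If a rule could reach the root of an instance of a non-variable subterm of `t`, the `TCap` test
would make it usable and hence put it in `U`. So all these positions are safe and no list is
created. -/
theorem interp_subst (t : L.Term V) (γ : V → L.Term V) (ht : Terminating R (t.subst γ))
    (hU : ∀ ρ, UsableT R (trivialFiltering L) t ρ → ρ ∈ U) :
    interp R U hb (t.subst γ) =
      ((LHom.sumInl : L →ᴸ withC L).onTerm t).subst fun x => interp R U hb (γ x) := by
  induction t with
  | var x => rfl
  | func f ts ih =>
    have hs : Safe R U f fun i => (ts i).subst γ := fun ss hss ρ hρ hρU τ hτ =>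
      hρU (hU ρ (UsableT.cap f ts ρ hρ (unifies_of_steps hss hτ)))
    rw [subst_func, interp_func_of_safe ht hs]
    simp only [LHom.onTerm, subst_func]
    congr 1
    ext i
    exact ih i (ht.arg i) fun ρ hρ => hU ρ (UsableT.arg f ts i ρ (Finset.mem_univ i) hρ)

/-- At an unsafe term the reduct is an entry of the list. At a safe term a root step uses a rule of
`U`, whose right-hand side is interpreted exactly because `U` is closed under usable rules; an
argument step preserves safety. -/
theorem steps_interp_of_step (hR : ∀ ρ ∈ R, ¬ IsVar ρ.lhs)
    (hU : ∀ ρ ∈ U, ∀ ρ', UsableT R (trivialFiltering L) ρ.rhs ρ' → ρ' ∈ U) {s t : L.Term V}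
    (h : Step R s t) (hs : Terminating R s) :
    Steps (Rule.toC '' U ∪ cEpsilon L V) (interp R U hb s) (interp R U hb t) := by
  induction h with
  | root ρ γ hρ =>
    have hst := Step.root ρ γ hρ
    rcases hl : ρ.lhs with x | ⟨f, ls⟩
    · exact absurd ⟨x, hl⟩ (hR ρ hρ)
    · by_cases hsafe : Safe R U f fun i => (ls i).subst γ
      · have hρU : ρ ∈ U := by
          by_contra hρU
          refine hsafe _ (fun i => Relation.ReflTransGen.refl) ρ hρ hρU γ ?_
          rw [hl, subst_func]
        rw [← hl, interp_subst ρ.rhs γ (hs.step hst) (hU ρ hρU)]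
        refine Relation.ReflTransGen.tail
          (Steps.mono Set.subset_union_right (steps_interp_subst ρ.lhs γ hs)) ?_
        exact Step.root ρ.toC _ (Or.inl ⟨ρ, hρU, rfl⟩)
      · rw [hl] at hs hst
        exact Steps.mono Set.subset_union_right (steps_interp_reduct hs hsafe hst)
  | arg f ts i t hit ih =>
    have hst := Step.arg f ts i t hit
    by_cases hsafe : Safe R U f ts
    · rw [interp_func_of_safe hs hsafe, interp_func_of_safe (hs.step hst) (hsafe.update hit)]
      refine Steps.func _ fun j => ?_
      by_cases hj : j = i
      · subst hj; simpa using ih (hs.arg j)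
      · rw [Function.update_of_ne hj]
        exact Relation.ReflTransGen.refl
    · exact Steps.mono Set.subset_union_right (steps_interp_reduct hs hsafe hst)

theorem steps_interp (hR : ∀ ρ ∈ R, ¬ IsVar ρ.lhs)
    (hU : ∀ ρ ∈ U, ∀ ρ', UsableT R (trivialFiltering L) ρ.rhs ρ' → ρ' ∈ U) {s t : L.Term V}
    (h : Steps R s t) (hs : Terminating R s) :
    Steps (Rule.toC '' U ∪ cEpsilon L V) (interp R U hb s) (interp R U hb t) := by
  induction h with
  | refl => exact Relation.ReflTransGen.refl
  | tail hab hbc ih => exact ih.trans (steps_interp_of_step hR hU hbc (hs.steps hab))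

/-! ### Soundness -/

theorem properRule_of_mem_relevantRules (A : DPProblem L V) {ρ : Rule (withC L) V}
    (h : ρ ∈ relevantRules A) : ProperRule ρ := by
  unfold relevantRules at h
  split at h
  · obtain ⟨ρ, hρ, rfl⟩ := h
    exact properRule_toC (A.R_lhs ρ hρ) (A.R_vars ρ hρ)
  · rcases h with ⟨ρ, ⟨p, _, hρ⟩, rfl⟩ | ⟨i, rfl⟩
    · exact properRule_toC (A.R_lhs ρ hρ.mem) (A.R_vars ρ hρ.mem)
    · exact properRule_projRule _ _

/-- A chain gives rise to a chain with the relevant rules over the larger signature. -/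
theorem exists_chain_relevantRules (A : DPProblem L V) {ρ : ℕ → Rule L V}
    {γ : ℕ → V → L.Term V} (hc : IsChain A.P A.R ρ γ)
    (hm : A.flag = Flag.minimal → IsMinimalChain A.R ρ γ) :
    ∃ γ' : ℕ → V → (withC L).Term V, ∀ i, Steps (relevantRules A)
      ((ρ i).toC.rhs.subst (γ' i)) ((ρ (i + 1)).toC.lhs.subst (γ' (i + 1))) := by
  have hall : Rule.toC '' A.R ⊆ relevantRules A → ∃ γ' : ℕ → V → (withC L).Term V,
      ∀ i, Steps (relevantRules A) ((ρ i).toC.rhs.subst (γ' i))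
        ((ρ (i + 1)).toC.lhs.subst (γ' (i + 1))) := fun h =>
    ⟨fun i x => (LHom.sumInl : L →ᴸ withC L).onTerm (γ i x), fun i => by
      have := Steps.mono h (hc.2 i).toC
      rwa [onTerm_subst, onTerm_subst] at this⟩
  rcases hf : A.flag with _ | _
  · have hrel : relevantRules A =
        Rule.toC '' usableRulesT A.P A.R (trivialFiltering L) ∪ cEpsilon L V := by
      simp only [relevantRules, hf]
    by_cases hb : FinitelyBranching A.R
    · have hmin := hm hf
      let I := interp A.R (usableRulesT A.P A.R (trivialFiltering L)) hb
      refine ⟨fun i x => I (γ i x), fun i => ?_⟩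
      -- Equality is needed here, since the right-hand side of a pair is where the new reduction
      -- starts; at its end `C_ε` steps suffice.
      have h1 : I ((ρ i).rhs.subst (γ i)) = (ρ i).toC.rhs.subst fun x => I (γ i x) :=
        interp_subst _ _ (hmin i) fun ρ' h => ⟨ρ i, hc.1 i, h⟩
      rw [hrel, ← h1]
      refine (steps_interp A.R_lhs ?_ (hc.2 i) (hmin i)).trans
        (Steps.mono Set.subset_union_right
          (steps_interp_subst _ _ ((hmin i).steps (hc.2 i))))
      rintro ρ₁ ⟨p, hp, h₁⟩ ρ₂ h₂
      exact ⟨p, hp, UsableT.rhs _ _ _ h₁ h₂⟩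
    · refine hall ?_
      rw [hrel]
      rintro _ ⟨ρ', hρ', rfl⟩
      -- The chain supplies a pair, so in the infinitely branching case every rule is usable and no
      -- interpretation is needed.
      exact Or.inl ⟨ρ', ⟨ρ 0, hc.1 0, UsableT.infinite _ _ hb hρ'⟩, rfl⟩
  · refine hall ?_
    simp only [relevantRules, hf]
    exact subset_rfl

theorem isFinite_of_orients {π : ArgFiltering (withC L)}
    {rp : ReductionPair (filteredLanguage π) V} {A : DPProblem L V} {Q : Set (Rule L V)}
    (h : Orients π rp A Q) (hfin : (A.remove Q).IsFinite) : A.IsFinite := by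
  rintro ⟨ρ, γ, hc, hm⟩
  obtain ⟨γ', hγ'⟩ := exists_chain_relevantRules A hc hm
  obtain ⟨_, hgt, hge, ho⟩ := h
  obtain ⟨n, hn⟩ := eventually_not_strict_of_chain (π := π) (rp := rp)
    (fun ρ hρ => properRule_of_mem_relevantRules A hρ) (G := fun i => ρ i ∈ Q) hγ'
    (fun i ρ' h => ho ρ' ⟨_, ⟨ρ i, hc.1 i, rfl⟩, h⟩) (fun i hi => hgt _ hi)
    (fun i hi => hge _ ⟨hc.1 i, hi⟩)
  -- The tail keeps its original substitutions and rules; the translated chain only served to bound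
  -- the strict pairs.
  refine hfin ⟨fun i => ρ (i + n), fun i => γ (i + n),
    ⟨fun i => ⟨hc.1 _, hn _ (by omega)⟩, fun i => ?_⟩, fun hf i => hm hf (i + n)⟩
  have := hc.2 (i + n)
  rwa [show i + n + 1 = i + 1 + n by omega] at this

end Usable

end TRS

theorem theoremC9 {L : FirstOrder.Language.{u, v}} {V : Type w} [Infinite V]
    (π : TRS.ArgFiltering (TRS.withC L))
    (rp : TRS.ReductionPair (TRS.filteredLanguage π) V)
    (S : TRS.DPProblem L V → Set (TRS.Rule L V)) :
    TRS.Sound (TRS.splitFormativeProcessor π rp S) := by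
  intro A hA
  unfold TRS.splitFormativeProcessor at hA
  split_ifs at hA with h
  · exact TRS.isFinite_of_orients h (hA _ rfl)
  · exact hA A rfl
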